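/- **Conventions.** Let $(\mathcal H,[\cdot,\cdot])$ be a complex Krein space with a canonical decomposition $\mathcal H=\mathcal H^-[\oplus]\mathcal H^+$, canonical projections $P^\pm$ and canonical symmetry $J=P^+-P^-$; thus $\mathcal H$ is a Hilbert space with respect to $\langle x,y\rangle=[x,Jy]$, with norm $\|x\|$, and closedness and density refer to this norm. Put $\mathcal H_\Gamma=\mathcal H\times\mathcal H$. A (linear) relation $T$ in $\mathcal H$ is a linear subset of $\mathcal H_\Gamma$. Its domain is $\mathcal D_T=\{x\mid \exists y\ (x,y)\in T\}$, and its multivalued part is $\operatorname{Ind}T=\{y\mid (0,y)\in T\}$. $T$ is an operator if $\operatorname{Ind}T=\{0\}$. The sum of relations $\hat+$ is the componentwise one, $S\,\hat+\,T=\{(x+u,y+v)\mid (x,y)\in S,\ (u,v)\in T\}$. The adjoint $T^c$ is the orthogonal complement of $T$ in $\mathcal H_\Gamma$ with respect to $$[(x_1,y_1),(x_2,y_2)]_\Gamma=-i\big([x_1,y_2]-[y_1,x_2]\big).$$ $T$ is symmetric if $[p,p]_\Gamma=0$ for all $p\in T$, and self-adjoint if $T=T^c$. Self-adjointness in the Hilbert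 space $(\mathcal H^-,-[\cdot,\cdot])$ is defined in the same way. A closed linear subset $M\subseteq\mathcal H$ is uniformly negative if there is $c>0$ with $[x,x]\le -c\|x\|^2$ for all $x\in M$. A relation $T$ is of class $(LP')$ if it is closed and symmetric, $\mathcal D_T$ contains a maximal uniformly negative subspace, and $\mathcal D_T+\operatorname{Ind}T$ is dense in $\mathcal H$. **Proposition 5.7.** Let $A$ be a closed symmetric relation in $\mathcal H=\mathcal H^-[\oplus]\mathcal H^+$, and let $L$ be a closed operator in $\mathcal H$ (for example the operator part of $A^c$) such that $$A^c=L\ \hat+\ (\{0\}\times\operatorname{Ind}A^c).$$ If $\mathcal H^-\subseteq\mathcal D_L$ and the operator $P^-L|_{\mathcal H^-}=\{(x,P^-z)\mid x\in\mathcal H^-,\ (x,z)\in L\}$ is self-adjoint in $(\mathcal H^-,-[\cdot,\cdot])$, then there is a closed symmetric relation $T$ with $A\subseteq T\subseteq A^c$ which is of class $(LP')$. -/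

import Mathlib

noncomputable section

namespace KreinRelation

/-! ### Linear relations in a linear space

A linear relation in `E` is a linear subset of `E × E`, i.e. a `Submodule ℂ (E × E)`. -/

section Relations

variable {E : Type*} [AddCommGroup E] [Module ℂ E]

/-- The domain of a relation. -/
def dom (T : Submodule ℂ (E × E)) : Submodule ℂ E := T.map (LinearMap.fst ℂ E E)

/-- The multivalued part (indefiniteness) `Ind T = {y | (0, y) ∈ T}`. -/
def ind (T : Submodule ℂ (E × E)) : Submodule ℂ E := T.comap (LinearMap.inr ℂ E E)

/-- A relation is (the graph of) an operator if its multivalued part is trivial. -/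
def IsOperator (T : Submodule ℂ (E × E)) : Prop := ind T = ⊥

/-- The form `[(x₁, y₁), (x₂, y₂)]_Γ = -i ([x₁, y₂] - [y₁, x₂])` on `E × E` attached to a
sesquilinear form `B = [·,·]` on `E` (conjugate-linear in the first variable). -/
def gammaForm (B : E →ₗ⋆[ℂ] E →ₗ[ℂ] ℂ) (p q : E × E) : ℂ :=
  -Complex.I * (B p.1 q.2 - B p.2 q.1)

/-- The adjoint of a relation with respect to `B`: its orthogonal complement in `E × E` with
respect to the form `[·,·]_Γ`. -/
def adj (B : E →ₗ⋆[ℂ] E →ₗ[ℂ] ℂ) (T : Submodule ℂ (E × E)) : Submodule ℂ (E × E) where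
  carrier := {p | ∀ q ∈ T, gammaForm B q p = 0}
  add_mem' := by
    intro a b ha hb q hq
    have h1 := ha q hq
    have h2 := hb q hq
    simp only [gammaForm, Prod.fst_add, Prod.snd_add, map_add] at h1 h2 ⊢
    linear_combination h1 + h2
  zero_mem' := by
    intro q _
    simp [gammaForm]
  smul_mem' := by
    intro c a ha q hq
    have h1 := ha q hq
    simp only [gammaForm, Prod.smul_fst, Prod.smul_snd, map_smul, smul_eq_mul] at h1 ⊢
    linear_combination c * h1

/-- A relation is symmetric if it is a neutral linear subset of `(E × E, [·,·]_Γ)`. -/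
def IsSymmetricRel (B : E →ₗ⋆[ℂ] E →ₗ[ℂ] ℂ) (T : Submodule ℂ (E × E)) : Prop :=
  ∀ p ∈ T, gammaForm B p p = 0

/-- A relation is self-adjoint if it coincides with its adjoint. -/
def IsSelfAdjointRel (B : E →ₗ⋆[ℂ] E →ₗ[ℂ] ℂ) (T : Submodule ℂ (E × E)) : Prop :=
  adj B T = T

end Relations

/-! ### Krein spaces with a given canonical decomposition

A Krein space together with a canonical decomposition `H = H⁻ [+] H⁺` is the same thing as a
Hilbert space `H`, with inner product `⟨x, y⟩ = [x, J y]`, and a canonical symmetry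
`J = P⁺ - P⁻`, i.e. a bounded self-adjoint operator with `J² = I`. -/

/-- A canonical symmetry `J = J* = J⁻¹` on a Hilbert space. -/
structure CanonicalSymmetry (H : Type*) [NormedAddCommGroup H] [InnerProductSpace ℂ H]
    [CompleteSpace H] where
  /-- the underlying operator -/
  J : H →L[ℂ] H
  isSelfAdjoint : IsSelfAdjoint J
  mul_self : J * J = 1

namespace CanonicalSymmetry

variable {H : Type*} [NormedAddCommGroup H] [InnerProductSpace ℂ H] [CompleteSpace H]
  (K : CanonicalSymmetry H)

/-- The indefinite inner product `[x, y] = ⟨x, J y⟩`, conjugate-linear in `x`. -/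
def form : H →ₗ⋆[ℂ] H →ₗ[ℂ] ℂ := (innerₛₗ ℂ).compl₂ (K.J : H →ₗ[ℂ] H)

/-- The canonical projection `P⁻ = (I - J) / 2`. -/
def Pneg : H →L[ℂ] H := (2⁻¹ : ℂ) • (1 - K.J)

/-- The negative component `H⁻` of the canonical decomposition, the eigenspace `J x = -x`. -/
def neg : Submodule ℂ H := LinearMap.ker ((K.J : H →ₗ[ℂ] H) + LinearMap.id)

/-- The Hilbert space inner product `-[·,·]` of `H⁻`. -/
def negForm : K.neg →ₗ⋆[ℂ] K.neg →ₗ[ℂ] ℂ :=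
  -((K.form.comp K.neg.subtype).compl₂ K.neg.subtype)

theorem Pneg_mem (x : H) : K.Pneg x ∈ K.neg := by
  have h : K.J (K.J x) = x := DFunLike.congr_fun K.mul_self x
  simp [neg, Pneg, h]

/-- The canonical projection `P⁻`, regarded as a map onto `H⁻`. -/
def PnegTo : H →ₗ[ℂ] K.neg := (K.Pneg : H →ₗ[ℂ] H).codRestrict K.neg K.Pneg_mem

/-- The relation `P⁻ T|H⁻` in `H⁻`: all pairs `(x, P⁻ z)` with `x ∈ H⁻` and `(x, z) ∈ T`. -/
def negCompression (T : Submodule ℂ (H × H)) : Submodule ℂ (K.neg × K.neg) :=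
  (T.comap (K.neg.subtype.prodMap LinearMap.id)).map (LinearMap.id.prodMap K.PnegTo)

/-- A uniformly negative subspace: closed, with `[x, x] ≤ -c ‖x‖²` for some `c > 0`. -/
def IsUniformlyNegative (M : Submodule ℂ H) : Prop :=
  IsClosed (M : Set H) ∧ ∃ c : ℝ, 0 < c ∧ ∀ x ∈ M, (K.form x x).re ≤ -c * ‖x‖ ^ 2

/-- Property (L): the domain contains a maximal uniformly negative subspace. -/
def PropL (T : Submodule ℂ (H × H)) : Prop :=
  ∃ M : Submodule ℂ H, Maximal K.IsUniformlyNegative M ∧ M ≤ dom T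

/-- Property (P'): `D_T + Ind T` is dense. -/
def PropP' (T : Submodule ℂ (H × H)) : Prop :=
  Dense ((dom T ⊔ ind T : Submodule ℂ H) : Set H)

/-- The set `Sym(A)` of closed symmetric canonical extensions `A ⊆ T ⊆ A^c`. -/
def Sym (A : Submodule ℂ (H × H)) : Set (Submodule ℂ (H × H)) :=
  {T | IsClosed (T : Set (H × H)) ∧ IsSymmetricRel K.form T ∧ A ≤ T ∧ T ≤ adj K.form A}

/-- The class (LP'): closed symmetric relations with the properties (L) and (P'). -/
structure IsLP' (T : Submodule ℂ (H × H)) : Prop where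
  isClosed : IsClosed (T : Set (H × H))
  isSymmetric : IsSymmetricRel K.form T
  propL : K.PropL T
  propP' : PropP' T

end CanonicalSymmetry

end KreinRelation

end

/-!
Extend `A` by `S₀ = L|H⁻`. Since `P⁻` is self-adjoint for `[·,·]` and acts as the identity on `H⁻`,
`S₀` is symmetric because `P⁻L|H⁻` is, so `S = A + S₀` is symmetric with `H⁻ ⊆ D_S`. Adding
`{0} × Ind S^c ⊆ S^c` keeps it symmetric, and forces property (P'): if `w` is orthogonal to
`D + Ind` of the enlarged relation, then `[x, Jw] = ⟨x, w⟩ = 0` on `D_S`, so `Jw ∈ Ind S^c` and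
`⟨Jw, w⟩ = 0`, while `w - Jw ∈ H⁻` gives `⟨w - Jw, w⟩ = 0`; hence `w = 0`. The closure of this
relation is `T`.
-/

namespace KreinRelation

section Relations

variable {E : Type*} [AddCommGroup E] [Module ℂ E] {B : E →ₗ⋆[ℂ] E →ₗ[ℂ] ℂ}
  {S T : Submodule ℂ (E × E)}

theorem gammaForm_add_left (p₁ p₂ q : E × E) :
    gammaForm B (p₁ + p₂) q = gammaForm B p₁ q + gammaForm B p₂ q := by
  simp only [gammaForm, Prod.fst_add, Prod.snd_add, map_add, LinearMap.add_apply]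
  ring

theorem gammaForm_add_right (p q₁ q₂ : E × E) :
    gammaForm B p (q₁ + q₂) = gammaForm B p q₁ + gammaForm B p q₂ := by
  simp only [gammaForm, Prod.fst_add, Prod.snd_add, map_add]
  ring

theorem gammaForm_smul_left (c : ℂ) (p q : E × E) :
    gammaForm B (c • p) q = (starRingEnd ℂ) c * gammaForm B p q := by
  simp only [gammaForm, Prod.smul_fst, Prod.smul_snd, LinearMap.map_smulₛₗ, LinearMap.smul_apply,
    smul_eq_mul]
  ring

theorem gammaForm_smul_right (c : ℂ) (p q : E × E) :
    gammaForm B p (c • q) = c * gammaForm B p q := by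
  simp only [gammaForm, Prod.smul_fst, Prod.smul_snd, map_smul, smul_eq_mul]
  ring

theorem conj_gammaForm (hB : B.IsSymm) (p q : E × E) :
    (starRingEnd ℂ) (gammaForm B p q) = gammaForm B q p := by
  simp only [gammaForm, map_mul, map_neg, map_sub, Complex.conj_I, hB.eq]
  ring

theorem dom_mono (h : S ≤ T) : dom S ≤ dom T := Submodule.map_mono h

theorem ind_mono (h : S ≤ T) : ind S ≤ ind T := Submodule.comap_mono h

theorem adj_anti (h : S ≤ T) : adj B T ≤ adj B S := fun _ hp q hq => hp q (h hq)

theorem ind_adj : ind (adj B T) = (dom T).orthogonalBilin B := by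
  ext y
  have gammaForm_eq_zero_iff (q : E × E) : gammaForm B q (0, y) = 0 ↔ B q.1 y = 0 := by
    simp [gammaForm]
  constructor
  · rintro hy _ ⟨q, hq, rfl⟩
    exact (gammaForm_eq_zero_iff q).1 (hy q hq)
  · exact fun hy q hq => (gammaForm_eq_zero_iff q).2 (hy q.1 ⟨q, hq, rfl⟩)

theorem bot_prod_ind_le (T : Submodule ℂ (E × E)) : (⊥ : Submodule ℂ E).prod (ind T) ≤ T := by
  rintro ⟨x, y⟩ ⟨hx, hy⟩
  obtain rfl : x = 0 := hx
  exact hy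

theorem isSymmetricRel_bot_prod (N : Submodule ℂ E) :
    IsSymmetricRel B ((⊥ : Submodule ℂ E).prod N) := by
  rintro ⟨x, y⟩ ⟨hx, -⟩
  obtain rfl : x = 0 := hx
  simp [gammaForm]

theorem IsSelfAdjointRel.isSymmetricRel (h : IsSelfAdjointRel B T) : IsSymmetricRel B T :=
  fun p hp => h.ge hp p hp

theorem IsSymmetricRel.le_adj (h : IsSymmetricRel B T) : T ≤ adj B T := by
  have add_swap {p q : E × E} (hp : p ∈ T) (hq : q ∈ T) :
      gammaForm B p q + gammaForm B q p = 0 := by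
    have hpq := h (p + q) (T.add_mem hp hq)
    rw [gammaForm_add_left, gammaForm_add_right, gammaForm_add_right, h p hp, h q hq] at hpq
    linear_combination hpq
  intro p hp q hq
  have hre := add_swap hq hp
  have him := add_swap hq (T.smul_mem Complex.I hp)
  rw [gammaForm_smul_left, gammaForm_smul_right, Complex.conj_I] at him
  linear_combination hre / 2 - Complex.I / 2 * him
    + (gammaForm B q p - gammaForm B p q) / 2 * Complex.I_sq

theorem IsSymmetricRel.sup (hB : B.IsSymm) (hS : IsSymmetricRel B S) (hT : IsSymmetricRel B T)
    (hTS : T ≤ adj B S) : IsSymmetricRel B (S ⊔ T) := by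
  intro p hp
  obtain ⟨s, hs, t, ht, rfl⟩ := Submodule.mem_sup.1 hp
  have hst : gammaForm B s t = 0 := hTS ht s hs
  have hts : gammaForm B t s = 0 := by rw [← conj_gammaForm hB, hst, map_zero]
  simp only [gammaForm_add_left, gammaForm_add_right, hS s hs, hT t ht, hst, hts, add_zero]

theorem IsSymmetricRel.topologicalClosure [TopologicalSpace E] [ContinuousAdd E]
    [ContinuousConstSMul ℂ E] (hB : Continuous fun p : E × E => B p.1 p.2)
    (hT : IsSymmetricRel B T) : IsSymmetricRel B T.topologicalClosure := by
  have hclosed : IsClosed {p | gammaForm B p p = 0} := by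
    have hswap : Continuous fun p : E × E => B p.2 p.1 := hB.comp continuous_swap
    exact isClosed_eq (continuous_const.mul (hB.sub hswap)) continuous_const
  exact closure_minimal hT hclosed

/-- The restriction `T|N` of a relation to a subspace `N`: the pairs in `T` with first component
in `N`. -/
def restrict (T : Submodule ℂ (E × E)) (N : Submodule ℂ E) : Submodule ℂ (E × E) :=
  T ⊓ N.comap (LinearMap.fst ℂ E E)

theorem restrict_le (T : Submodule ℂ (E × E)) (N : Submodule ℂ E) : restrict T N ≤ T :=
  inf_le_left

theorem dom_restrict (T : Submodule ℂ (E × E)) (N : Submodule ℂ E) :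
    dom (restrict T N) = dom T ⊓ N :=
  Submodule.map_inf_eq_map_inf_comap.symm

/-- The relation `T + ({0} × Ind T^c)`, obtained from `T` by enlarging its multivalued part as far
as the domain of `T` allows for a symmetric relation. -/
def adjIndExtension (B : E →ₗ⋆[ℂ] E →ₗ[ℂ] ℂ) (T : Submodule ℂ (E × E)) : Submodule ℂ (E × E) :=
  T ⊔ (⊥ : Submodule ℂ E).prod (ind (adj B T))

theorem le_adjIndExtension (T : Submodule ℂ (E × E)) : T ≤ adjIndExtension B T := le_sup_left

theorem IsSymmetricRel.adjIndExtension (hB : B.IsSymm) (hT : IsSymmetricRel B T) :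
    IsSymmetricRel B (adjIndExtension B T) :=
  hT.sup hB (isSymmetricRel_bot_prod _) (bot_prod_ind_le _)

theorem ind_adj_adjIndExtension_le (T : Submodule ℂ (E × E)) :
    ind (adj B (adjIndExtension B T)) ≤ ind (adjIndExtension B T) :=
  calc ind (adj B (adjIndExtension B T))
    _ ≤ ind (adj B T) := ind_mono (adj_anti (le_adjIndExtension T))
    _ ≤ ind (adjIndExtension B T) := fun _ hy =>
      Submodule.mem_sup_right ⟨Submodule.zero_mem _, hy⟩

end Relations

namespace CanonicalSymmetry

variable {H : Type*} [NormedAddCommGroup H] [InnerProductSpace ℂ H] [CompleteSpace H]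
  (K : CanonicalSymmetry H)

theorem J_J (x : H) : K.J (K.J x) = x := DFunLike.congr_fun K.mul_self x

theorem inner_J_left (x y : H) : inner ℂ (K.J x) y = inner ℂ x (K.J y) :=
  K.isSelfAdjoint.isSymmetric x y

theorem form_apply (x y : H) : K.form x y = inner ℂ x (K.J y) := rfl

theorem form_J_right (x y : H) : K.form x (K.J y) = inner ℂ x y := by
  rw [form_apply, J_J]

theorem isSymm_form : K.form.IsSymm where
  eq x y := by rw [form_apply, form_apply, inner_conj_symm, inner_J_left]

theorem continuous_form : Continuous fun p : H × H => K.form p.1 p.2 := by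
  simp only [form_apply]
  fun_prop

theorem mem_neg {x : H} : x ∈ K.neg ↔ K.J x = -x := by
  simp [neg, eq_neg_iff_add_eq_zero]

theorem sub_J_mem_neg (x : H) : x - K.J x ∈ K.neg := by
  rw [mem_neg, map_sub, J_J, neg_sub]

theorem J_sub_Pneg (x : H) : K.J (x - K.Pneg x) = x - K.Pneg x := by
  simp only [Pneg, smul_apply, sub_apply, one_apply_eq_self, map_smul, map_sub, J_J]
  module

theorem form_Pneg_right {x : H} (hx : x ∈ K.neg) (y : H) : K.form x (K.Pneg y) = K.form x y := by
  have h : inner ℂ x y = -K.form x y := by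
    rw [form_apply, ← inner_J_left, K.mem_neg.1 hx, inner_neg_left, neg_neg]
  simp only [Pneg, smul_apply, sub_apply, one_apply_eq_self, map_smul, map_sub, smul_eq_mul,
    form_J_right, h]
  ring

theorem form_Pneg_left (x : H) {y : H} (hy : y ∈ K.neg) : K.form (K.Pneg x) y = K.form x y := by
  rw [← K.isSymm_form.eq, K.form_Pneg_right hy, K.isSymm_form.eq]

theorem isClosed_neg : IsClosed (K.neg : Set H) := by
  have h : (K.neg : Set H) = {x | K.J x = -x} := Set.ext fun x => K.mem_neg
  rw [h]
  exact isClosed_eq K.J.continuous continuous_neg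

theorem isUniformlyNegative_neg : K.IsUniformlyNegative K.neg := by
  refine ⟨K.isClosed_neg, 1, one_pos, fun x hx => le_of_eq ?_⟩
  rw [form_apply, K.mem_neg.1 hx, inner_neg_right, Complex.neg_re, neg_one_mul]
  exact congrArg Neg.neg (inner_self_eq_norm_sq (𝕜 := ℂ) x)

variable {K} in
theorem IsUniformlyNegative.eq_zero_of_J_eq {M : Submodule ℂ H} (hM : K.IsUniformlyNegative M)
    {x : H} (hx : x ∈ M) (hJ : K.J x = x) : x = 0 := by
  obtain ⟨-, c, hc, hneg⟩ := hM
  have hle : ‖x‖ ^ 2 ≤ -c * ‖x‖ ^ 2 := by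
    have hform : (K.form x x).re = ‖x‖ ^ 2 := by
      rw [form_apply, hJ]
      exact inner_self_eq_norm_sq (𝕜 := ℂ) x
    exact hform ▸ hneg x hx
  have hsq : ‖x‖ ^ 2 = 0 := by nlinarith [sq_nonneg ‖x‖]
  exact norm_eq_zero.1 (pow_eq_zero_iff two_ne_zero |>.1 hsq)

theorem maximal_isUniformlyNegative_neg : Maximal K.IsUniformlyNegative K.neg := by
  refine ⟨K.isUniformlyNegative_neg, fun M hM hle x hx => ?_⟩
  have hmem : x - K.Pneg x ∈ M := M.sub_mem hx (hle (K.Pneg_mem x))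
  have hzero : x - K.Pneg x = 0 := hM.eq_zero_of_J_eq hmem (K.J_sub_Pneg x)
  rw [sub_eq_zero.1 hzero]
  exact K.Pneg_mem x

theorem gammaForm_negForm (x u : K.neg) (z w : H) :
    gammaForm K.negForm (x, K.PnegTo z) (u, K.PnegTo w) =
      -gammaForm K.form ((x : H), z) ((u : H), w) := by
  have negForm_PnegTo_right : K.negForm x (K.PnegTo w) = -K.form x w :=
    congrArg Neg.neg (K.form_Pneg_right x.2 w)
  have negForm_PnegTo_left : K.negForm (K.PnegTo z) u = -K.form z u :=
    congrArg Neg.neg (K.form_Pneg_left z u.2)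
  simp only [gammaForm, negForm_PnegTo_right, negForm_PnegTo_left]
  ring

theorem isSymmetricRel_restrict_neg {L : Submodule ℂ (H × H)}
    (hL : IsSymmetricRel K.negForm (K.negCompression L)) :
    IsSymmetricRel K.form (restrict L K.neg) := by
  rintro ⟨x, z⟩ ⟨hxz, hx⟩
  have h := hL (⟨x, hx⟩, K.PnegTo z) ⟨(⟨x, hx⟩, z), hxz, rfl⟩
  rwa [gammaForm_negForm, neg_eq_zero] at h

omit [CompleteSpace H] in
theorem PropP'.mono {S T : Submodule ℂ (H × H)} (h : S ≤ T) (hS : PropP' S) : PropP' T :=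
  Dense.mono (sup_le_sup (dom_mono h) (ind_mono h)) hS

theorem propP'_of_ind_adj_le_ind {T : Submodule ℂ (H × H)} (hneg : K.neg ≤ dom T)
    (hind : ind (adj K.form T) ≤ ind T) : PropP' T := by
  rw [PropP', Submodule.dense_iff_topologicalClosure_eq_top,
    Submodule.topologicalClosure_eq_top_iff, Submodule.eq_bot_iff]
  intro w hw
  rw [← Submodule.inf_orthogonal] at hw
  obtain ⟨hdom_perp, hind_perp⟩ := hw
  have hJw : K.J w ∈ ind T := by
    refine hind (ind_adj.ge fun x hx => ?_)
    rw [form_J_right]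
    exact hdom_perp x hx
  have hJ : inner ℂ (K.J w) w = 0 := hind_perp _ hJw
  have hsub : inner ℂ (w - K.J w) w = 0 := hdom_perp _ (hneg (K.sub_J_mem_neg w))
  rw [inner_sub_left, hJ, sub_zero] at hsub
  exact inner_self_eq_zero.1 hsub

theorem isLP'_topologicalClosure_adjIndExtension {S : Submodule ℂ (H × H)}
    (hS : IsSymmetricRel K.form S) (hneg : K.neg ≤ dom S) :
    K.IsLP' (adjIndExtension K.form S).topologicalClosure := by
  set S' := adjIndExtension K.form S
  have hS' : S' ≤ S'.topologicalClosure := S'.le_topologicalClosure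
  have hneg' : K.neg ≤ dom S' := hneg.trans (dom_mono (le_adjIndExtension S))
  exact
    { isClosed := S'.isClosed_topologicalClosure
      isSymmetric := (hS.adjIndExtension K.isSymm_form).topologicalClosure K.continuous_form
      propL := ⟨K.neg, K.maximal_isUniformlyNegative_neg, hneg'.trans (dom_mono hS')⟩
      propP' := (K.propP'_of_ind_adj_le_ind hneg' (ind_adj_adjIndExtension_le S)).mono hS' }

variable {K} in
theorem IsLP'.mem_Sym {A T : Submodule ℂ (H × H)} (hT : K.IsLP' T) (hAT : A ≤ T) : T ∈ K.Sym A :=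
  ⟨hT.isClosed, hT.isSymmetric, hAT, hT.isSymmetric.le_adj.trans (adj_anti hAT)⟩

end CanonicalSymmetry

end KreinRelation

open KreinRelation in
theorem proposition5p7_general {H : Type*} [NormedAddCommGroup H] [InnerProductSpace ℂ H]
    [CompleteSpace H] (K : CanonicalSymmetry H) {A L : Submodule ℂ (H × H)}
    (hA : IsSymmetricRel K.form A) (hLA : L ≤ adj K.form A) (hneg : K.neg ≤ dom L)
    (hL : IsSymmetricRel K.negForm (K.negCompression L)) :
    ∃ T ∈ K.Sym A, K.IsLP' T := by
  set S := A ⊔ restrict L K.neg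
  have hS : IsSymmetricRel K.form S :=
    hA.sup K.isSymm_form (K.isSymmetricRel_restrict_neg hL) ((restrict_le L K.neg).trans hLA)
  have hSneg : K.neg ≤ dom S :=
    calc K.neg
      _ ≤ dom (restrict L K.neg) := (le_inf hneg le_rfl).trans (dom_restrict L K.neg).ge
      _ ≤ dom S := dom_mono le_sup_right
  have hT := K.isLP'_topologicalClosure_adjIndExtension hS hSneg
  have hAT : A ≤ (adjIndExtension K.form S).topologicalClosure :=
    le_sup_left.trans ((le_adjIndExtension S).trans (Submodule.le_topologicalClosure _))
  exact ⟨_, hT.mem_Sym hAT, hT⟩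

theorem proposition5p7 {H : Type*} [NormedAddCommGroup H] [InnerProductSpace ℂ H]
    [CompleteSpace H] (K : KreinRelation.CanonicalSymmetry H)
    (A : Submodule ℂ (H × H)) (hA_closed : IsClosed (A : Set (H × H)))
    (hA_symm : KreinRelation.IsSymmetricRel K.form A)
    (L : Submodule ℂ (H × H)) (hL_closed : IsClosed (L : Set (H × H)))
    (hL_op : KreinRelation.IsOperator L)
    (hAL : KreinRelation.adj K.form A =
      L ⊔ (⊥ : Submodule ℂ H).prod (KreinRelation.ind (KreinRelation.adj K.form A)))
    (hL_dom : K.neg ≤ KreinRelation.dom L)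
    (hL_sa : KreinRelation.IsSelfAdjointRel K.negForm (K.negCompression L)) :
    ∃ T ∈ K.Sym A, K.IsLP' T :=
  proposition5p7_general K hA_symm (le_sup_left.trans hAL.ge) hL_dom hL_sa.isSymmetricRel
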